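/- For an integer $D\ge 2$ let $\mathbb H^D=\{p=(x(p),z(p)) : x(p)\in\mathbb R^{D-1},\ z(p)>0\}$ be the Poincaré half-space, with the hyperbolic distance $$d_H(p,q)=2\operatorname{arsinh}\left(\frac12\,\frac{\|pq\|}{\sqrt{z(p)z(q)}}\right),$$ where $\|pq\|$ is the Euclidean distance in $\mathbb R^D$. A cell of level $i\in\mathbb Z$ is a set $$[k_12^i,(k_1+1)2^i]\times\dots\times[k_{D-1}2^i,(k_{D-1}+1)2^i]\times[2^i,2^{i+1}],\qquad k_1,\dots,k_{D-1}\in\mathbb Z.$$ The parent of a cell $\mathcal C$ of level $i$ is the cell of level $i+1$ whose bottom facet contains the upper facet of $\mathcal C$; the children of $\mathcal C$ are the cells whose parent is $\mathcal C$; the horizontal neighbors of $\mathcal C$ are the cells of the same level that are different from $\mathcal C$ and intersect $\mathcal C$. Let $\mathbb B^D$ be the set of the centers of all cells. A move goes from the center of a cell to the center of its parent or of one of its children (vertical moves), or of one of its horizontal neighbors (horizontal moves). For $u,v\in\mathbb B^D$ let $d_1(u,v)$ be the minimum number of moves needed to reach $v$ from $u$, and let $d_2(u,v)$ be the minimum number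 of moves of a path from $u$ to $v$ that has at most one horizontal move. Theorem 2. There is an absolute constant $K$ such that the following holds for every $D\ge 2$. Let $b:\mathbb H^D\to\mathbb B^D$ be any map that sends each point $p$ to the center of a cell that contains $p$ and has maximum level among the cells that contain $p$. Then for all $p,q\in\mathbb H^D$, $$|d_H(p,q)-\ln(2)\cdot d_1(b(p),b(q))|\le 3\ln(D)+K\quad\text{and}\quad |d_H(p,q)-\ln(2)\cdot d_2(b(p),b(q))|\le 3\ln(D)+K .$$ -/

import Mathlib

/-- The Poincaré half-space `ℍ^D`: points `(x, z)` with `x ∈ ℝ^(D-1)` and `z > 0`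
(meant for `D ≥ 2`). -/
@[ext]
structure HalfSpace (D : ℕ) where
  x : EuclideanSpace ℝ (Fin (D - 1))
  z : ℝ
  z_pos : 0 < z

namespace HalfSpace

variable {D : ℕ}

/-- The Euclidean distance `‖pq‖` in `ℝ^D = ℝ^(D-1) × ℝ`. -/
noncomputable def euclDist (p q : HalfSpace D) : ℝ :=
  Real.sqrt (‖p.x - q.x‖ ^ 2 + (p.z - q.z) ^ 2)

/-- The hyperbolic distance `d_H(p,q) = 2 arsinh (‖pq‖ / (2 √(z(p) z(q))))`
(the same formula as for Mathlib's `UpperHalfPlane`). -/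
noncomputable def dH (p q : HalfSpace D) : ℝ :=
  2 * Real.arsinh (1 / 2 * (euclDist p q / Real.sqrt (p.z * q.z)))

end HalfSpace

/-- Index of a cell of the binary tiling of `ℍ^D`: the integers `k₁, …, k_{D-1}` and the level. -/
@[ext]
structure Cell (D : ℕ) where
  k : Fin (D - 1) → ℤ
  level : ℤ

namespace Cell

variable {D : ℕ}

/-- The cell `∏ⱼ [kⱼ 2^i, (kⱼ+1) 2^i] × [2^i, 2^(i+1)]`, where `i` is the level. -/
def carrier (C : Cell D) : Set (HalfSpace D) :=
  {p | (∀ j, (C.k j : ℝ) * 2 ^ C.level ≤ p.x j ∧ p.x j ≤ ((C.k j : ℝ) + 1) * 2 ^ C.level) ∧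
    (2 : ℝ) ^ C.level ≤ p.z ∧ p.z ≤ (2 : ℝ) ^ (C.level + 1)}

/-- The upper facet of a cell. -/
def upperFacet (C : Cell D) : Set (HalfSpace D) :=
  {p | p ∈ C.carrier ∧ p.z = (2 : ℝ) ^ (C.level + 1)}

/-- The bottom facet of a cell. -/
def bottomFacet (C : Cell D) : Set (HalfSpace D) :=
  {p | p ∈ C.carrier ∧ p.z = (2 : ℝ) ^ C.level}

/-- `P` is the parent of `C`: it lies one level higher and its bottom facet contains the upper
facet of `C`. (Equivalently, `C` is a child of `P`.) -/
def IsParent (P C : Cell D) : Prop :=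
  P.level = C.level + 1 ∧ C.upperFacet ⊆ P.bottomFacet

/-- `C'` is a horizontal neighbor of `C`: a different cell of the same level that meets `C`. -/
def IsHorizontalNeighbor (C C' : Cell D) : Prop :=
  C'.level = C.level ∧ C' ≠ C ∧ (C.carrier ∩ C'.carrier).Nonempty

/-- The center of a cell. -/
noncomputable def center (C : Cell D) : HalfSpace D where
  x := WithLp.toLp 2 fun j => ((C.k j : ℝ) + 1 / 2) * 2 ^ C.level
  z := 3 * 2 ^ (C.level - 1)
  z_pos := by positivity

end Cell

/-- The discrete model `𝔹^D`: the set of all centers of cells. -/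
def DiscreteModel (D : ℕ) : Set (HalfSpace D) :=
  Set.range Cell.center

namespace DiscreteModel

variable {D : ℕ}

/-- A vertical move: from the center of a cell to the center of its parent (upward move) or of one
of its children (downward move). -/
def VerticalMove (p q : DiscreteModel D) : Prop :=
  ∃ C C' : Cell D, C.center = p ∧ C'.center = q ∧ (C'.IsParent C ∨ C.IsParent C')

/-- A horizontal move: from the center of a cell to the center of a horizontal neighbor. -/
def HorizontalMove (p q : DiscreteModel D) : Prop :=
  ∃ C C' : Cell D, C.center = p ∧ C'.center = q ∧ C.IsHorizontalNeighbor C'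

/-- `Path p q n h`: there is a path from `p` to `q` with `n` moves, of which exactly `h` are
horizontal. -/
inductive Path : DiscreteModel D → DiscreteModel D → ℕ → ℕ → Prop
  | nil (p : DiscreteModel D) : Path p p 0 0
  | vertical {p q r : DiscreteModel D} {n h : ℕ} :
      Path p q n h → VerticalMove q r → Path p r (n + 1) h
  | horizontal {p q r : DiscreteModel D} {n h : ℕ} :
      Path p q n h → HorizontalMove q r → Path p r (n + 1) (h + 1)

/-- `d₁(p,q)`: the minimum number of moves needed to reach `q` from `p`. -/
noncomputable def d1 (p q : DiscreteModel D) : ℕ :=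
  sInf {n | ∃ h, Path p q n h}

/-- `d₂(p,q)`: the length of a shortest path from `p` to `q` with at most one horizontal move. -/
noncomputable def d2 (p q : DiscreteModel D) : ℕ :=
  sInf {n | ∃ h ≤ 1, Path p q n h}

/-- `b` sends each point `p` of `ℍ^D` to the center of a cell that contains `p` and has the maximum
level among the cells that contain `p`. -/
def IsCellCenterMap (b : HalfSpace D → DiscreteModel D) : Prop :=
  ∀ p, ∃ C : Cell D, C.center = b p ∧ p ∈ C.carrier ∧
    ∀ C' : Cell D, p ∈ C'.carrier → C'.level ≤ C.level

/-! The minima that define `d₁` and `d₂` are over non-empty sets, and cell center maps exist. -/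

theorem Path.trans {p q r : DiscreteModel D} {n h m l : ℕ} (h₁ : Path p q n h)
    (h₂ : Path q r m l) : Path p r (n + m) (h + l) := by
  induction h₂ with
  | nil => exact h₁
  | vertical _ hv ih => exact ih.vertical hv
  | horizontal _ hv ih => exact ih.horizontal hv

theorem exists_isParent (C : Cell D) :
    Cell.IsParent (⟨fun j => C.k j / 2, C.level + 1⟩ : Cell D) C := by
  refine ⟨rfl, ?_⟩
  rintro p ⟨⟨hx, hz⟩, hp⟩
  refine ⟨⟨fun j => ?_, hp.ge, hp.trans_le ?_⟩, hp⟩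
  · obtain ⟨h1, h2⟩ := hx j
    have e : (2 : ℝ) ^ (C.level + 1) = 2 * 2 ^ C.level := by
      rw [zpow_add₀ two_ne_zero, zpow_one, mul_comm]
    have pos : (0 : ℝ) < 2 ^ C.level := by positivity
    have a1 : ((C.k j / 2 : ℤ) : ℝ) * 2 ≤ C.k j := by
      exact_mod_cast (by omega : C.k j / 2 * 2 ≤ C.k j)
    have a2 : (C.k j : ℝ) + 1 ≤ (((C.k j / 2 : ℤ) : ℝ) + 1) * 2 := by
      exact_mod_cast (by omega : C.k j + 1 ≤ (C.k j / 2 + 1) * 2)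
    simp only [e]
    constructor <;> nlinarith
  · exact zpow_le_zpow_right₀ one_le_two (by simp)

/-- The ancestor `n` levels up is connected to a cell by `n` vertical moves, in both directions. -/
theorem path_up_down (C : Cell D) (n : ℕ) :
    Path ⟨C.center, C, rfl⟩
      ⟨(⟨fun j => C.k j / 2 ^ n, C.level + n⟩ : Cell D).center, _, rfl⟩ n 0 ∧
    Path ⟨(⟨fun j => C.k j / 2 ^ n, C.level + n⟩ : Cell D).center, _, rfl⟩
      ⟨C.center, C, rfl⟩ n 0 := by
  induction n with
  | zero =>
    have e : (⟨fun j => C.k j / 2 ^ 0, C.level + (0 : ℕ)⟩ : Cell D) = C := by ext <;> simp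
    simp only [e]
    exact ⟨Path.nil _, Path.nil _⟩
  | succ n ih =>
    have hp := exists_isParent (⟨fun j => C.k j / 2 ^ n, C.level + n⟩ : Cell D)
    have e : (⟨fun j => C.k j / 2 ^ n / 2, C.level + n + 1⟩ : Cell D) =
        ⟨fun j => C.k j / 2 ^ (n + 1), C.level + (n + 1 : ℕ)⟩ := by
      ext
      · simp [pow_succ, Int.ediv_ediv_of_nonneg]
      · push_cast; ring
    simp only [e] at hp
    refine ⟨ih.1.vertical ⟨_, _, rfl, rfl, Or.inl hp⟩, ?_⟩
    have hm : VerticalMove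
        ⟨(⟨fun j => C.k j / 2 ^ (n + 1), C.level + (n + 1 : ℕ)⟩ : Cell D).center, _, rfl⟩
        ⟨(⟨fun j => C.k j / 2 ^ n, C.level + n⟩ : Cell D).center, _, rfl⟩ :=
      ⟨_, _, rfl, rfl, Or.inr hp⟩
    have := ((Path.nil _).vertical hm).trans ih.2
    simp only [zero_add] at this
    convert this using 1
    omega

theorem exists_path (p q : DiscreteModel D) : ∃ n, ∃ h ≤ 1, Path p q n h := by
  obtain ⟨_, C, rfl⟩ := p
  obtain ⟨_, C', rfl⟩ := q
  set N : ℕ := ∑ j, ((C.k j).natAbs + (C'.k j).natAbs) with hN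
  have key : ∀ (a : ℤ) (m : ℕ), a.natAbs ≤ m → a / 2 ^ m = 0 ∨ a / 2 ^ m = -1 := by
    intro a m ham
    have h2 : (m : ℤ) < 2 ^ m := by exact_mod_cast Nat.lt_two_pow_self
    have l1 : a / 2 ^ m < 1 := Int.ediv_lt_of_lt_mul (by positivity) (by omega)
    have l2 : -1 ≤ a / 2 ^ m := (Int.le_ediv_iff_mul_le (by positivity)).2 (by omega)
    omega
  have hj : ∀ j, (C.k j).natAbs + (C'.k j).natAbs ≤ N := fun j =>
    Finset.single_le_sum (f := fun j => (C.k j).natAbs + (C'.k j).natAbs)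
      (fun _ _ => Nat.zero_le _) (Finset.mem_univ j)
  set n := N + (C'.level - C.level).toNat with hn
  set m := N + (C.level - C'.level).toNat with hm
  have h1 := (path_up_down C n).1
  have h2 := (path_up_down C' m).2
  have k1 : ∀ j, C.k j / 2 ^ n = 0 ∨ C.k j / 2 ^ n = -1 := fun j =>
    key _ _ (by have := hj j; omega)
  have k2 : ∀ j, C'.k j / 2 ^ m = 0 ∨ C'.k j / 2 ^ m = -1 := fun j =>
    key _ _ (by have := hj j; omega)
  have hl : C'.level + m = C.level + n := by omega
  generalize hA : (⟨fun j => C.k j / 2 ^ n, C.level + n⟩ : Cell D) = A at h1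
  generalize hB : (⟨fun j => C'.k j / 2 ^ m, C'.level + m⟩ : Cell D) = B at h2
  by_cases hAB : B = A
  · subst hAB
    exact ⟨_, _, by norm_num, h1.trans h2⟩
  · refine ⟨_, _, ?_, (h1.horizontal ⟨A, B, rfl, rfl, ?_, hAB, ?_⟩).trans h2⟩
    · norm_num
    · rw [← hA, ← hB]; exact hl
    · have z0 : ∀ (a : ℤ) (t : ℝ), 0 < t → (a = 0 ∨ a = -1) →
          (a : ℝ) * t ≤ 0 ∧ 0 ≤ ((a : ℝ) + 1) * t := by
        rintro a t ht (rfl | rfl) <;> simp [ht.le]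
      have hle : ∀ i : ℤ, (2 : ℝ) ^ i ≤ 2 ^ (i + 1) := fun i =>
        zpow_le_zpow_right₀ one_le_two (by simp)
      refine ⟨⟨0, 2 ^ (C.level + n), by positivity⟩, ?_, ?_⟩
      · rw [← hA]
        exact ⟨fun j => by simpa using z0 _ _ (by positivity) (k1 j), le_rfl, hle _⟩
      · rw [← hB, hl]
        exact ⟨fun j => by simpa using z0 _ _ (by positivity) (k2 j), le_rfl, hle _⟩

theorem exists_isCellCenterMap (D : ℕ) :
    ∃ b : HalfSpace D → DiscreteModel D, IsCellCenterMap b := by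
  have key : ∀ p : HalfSpace D, ∃ C : Cell D, p ∈ C.carrier ∧
      ∀ C' : Cell D, p ∈ C'.carrier → C'.level ≤ C.level := by
    intro p
    have hf : (2 : ℝ) ^ Int.log 2 p.z ≤ p.z := by
      exact_mod_cast Int.zpow_log_le_self (b := 2) one_lt_two p.z_pos
    have hs : p.z < (2 : ℝ) ^ (Int.log 2 p.z + 1) := by
      exact_mod_cast Int.lt_zpow_succ_log_self (b := 2) one_lt_two p.z
    have pos : (0 : ℝ) < 2 ^ Int.log 2 p.z := by positivity
    refine ⟨⟨fun j => ⌊p.x j / 2 ^ Int.log 2 p.z⌋, Int.log 2 p.z⟩,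
      ⟨fun j => ⟨?_, ?_⟩, hf, hs.le⟩, ?_⟩
    · exact (le_div_iff₀ pos).1 (Int.floor_le _)
    · exact (div_le_iff₀ pos).1 (Int.lt_floor_add_one _).le
    · rintro C' ⟨_, h, _⟩
      have := (zpow_lt_zpow_iff_right₀ (one_lt_two : (1 : ℝ) < 2)).1 (h.trans_lt hs)
      change C'.level ≤ Int.log 2 p.z
      omega
  choose f hf using key
  exact ⟨fun p => ⟨(f p).center, f p, rfl⟩, fun p => ⟨f p, rfl, hf p⟩⟩

end DiscreteModel

/-! Both inequalities hold even with `log D + log 64` on the right. Since `d1 ≤ d2`, it is enough to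
bound `dH` above in terms of `d1`, and `d2` above in terms of `dH`. Both bounds compare powers of two
with `t ^ 2`, where `t = ‖pq‖ / √(z(p) z(q))` and `dH p q = 2 arsinh (t / 2)`.

* Upper bound for `dH` (`DiscreteModel.dH_le_of_path`). Take a path with `n` moves between cells of
  levels `i` and `j`. If it reaches level `L`, then it needs `2L - i - j` vertical moves to do so, and
  the number `e` of the other moves satisfies `n = 2L - i - j + e`. No move shifts a coordinate by
  more than `2 ^ L`, and the shifts of a monotone climb form a geometric series, so each coordinate
  changes by at most `2 ^ L (1 + e)` (`DiscreteModel.Path.displacement`). Hence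
  `t ^ 2 ≤ D (2 + e) ^ 2 2 ^ (n - e) ≤ 16 D 2 ^ n`: the factor `2 ^ (-e)` absorbs the polynomial in
  `e`, and the dimension enters only through comparing the maximum norm with the Euclidean norm.
* Upper bound for `d2` (`DiscreteModel.log_two_mul_d2_le`). Climb from both cells to a common level
  `L` with `‖x(p) - x(q)‖ < 2 ^ L`, where the two ancestors are equal or neighbors, so that
  `d2 ≤ 2L - i - j + 1`. With `L` minimal, either `L = max i j` and the ratio of `z(p)` and `z(q)`
  makes `t` large, or `2 ^ (L - 1) ≤ ‖x(p) - x(q)‖` does. -/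

/-! ### Estimates for `arsinh` -/

theorem Real.two_mul_arsinh (s : ℝ) :
    2 * Real.arsinh s = Real.log ((s + √(1 + s ^ 2)) ^ 2) := by
  rw [Real.arsinh, Real.log_pow]; norm_num

theorem Real.two_mul_arsinh_half_le {t T : ℝ} (ht : 0 ≤ t) (hT : 1 ≤ T) (h : t ^ 2 ≤ T) :
    2 * Real.arsinh (1 / 2 * t) ≤ Real.log (4 * T) := by
  rw [Real.two_mul_arsinh]
  have hs := Real.sqrt_nonneg (1 + (1 / 2 * t) ^ 2)
  have hs2 := Real.sq_sqrt (show 0 ≤ 1 + (1 / 2 * t) ^ 2 by positivity)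
  apply Real.log_le_log (by positivity)
  nlinarith [sq_nonneg (1 / 2 * t - √(1 + (1 / 2 * t) ^ 2))]

theorem Real.log_one_add_half_sq_le {t : ℝ} (ht : 0 ≤ t) :
    Real.log (1 + t ^ 2 / 2) ≤ 2 * Real.arsinh (1 / 2 * t) := by
  rw [Real.two_mul_arsinh]
  have hs := Real.sqrt_nonneg (1 + (1 / 2 * t) ^ 2)
  have hs2 := Real.sq_sqrt (show 0 ≤ 1 + (1 / 2 * t) ^ 2 by positivity)
  apply Real.log_le_log (by positivity)
  nlinarith [mul_nonneg ht hs]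

/-! ### The hyperbolic distance -/

namespace HalfSpace

variable {D : ℕ}

/-- The square of the quotient `‖pq‖ / √(z(p) z(q))` on which `dH` depends. -/
noncomputable def sqRatio (p q : HalfSpace D) : ℝ :=
  (‖p.x - q.x‖ ^ 2 + (p.z - q.z) ^ 2) / (p.z * q.z)

theorem sq_euclDist_div (p q : HalfSpace D) :
    (euclDist p q / √(p.z * q.z)) ^ 2 = sqRatio p q := by
  have := p.z_pos
  have := q.z_pos
  rw [div_pow, euclDist, Real.sq_sqrt (by positivity), Real.sq_sqrt (by positivity), sqRatio]

theorem euclDist_div_nonneg (p q : HalfSpace D) : 0 ≤ euclDist p q / √(p.z * q.z) :=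
  div_nonneg (Real.sqrt_nonneg _) (Real.sqrt_nonneg _)

theorem dH_le {p q : HalfSpace D} {T : ℝ} (hT : 1 ≤ T) (h : sqRatio p q ≤ T) :
    dH p q ≤ Real.log (4 * T) :=
  Real.two_mul_arsinh_half_le (euclDist_div_nonneg p q) hT (by rwa [sq_euclDist_div])

theorem log_one_add_sqRatio_le (p q : HalfSpace D) :
    Real.log (1 + sqRatio p q / 2) ≤ dH p q := by
  have := Real.log_one_add_half_sq_le (euclDist_div_nonneg p q)
  rwa [sq_euclDist_div] at this

end HalfSpace

/-! ### Geometry of the cells -/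

namespace Cell

variable {D : ℕ}

theorem two_zpow_succ (i : ℤ) : (2 : ℝ) ^ (i + 1) = 2 * 2 ^ i := by
  rw [zpow_add₀ two_ne_zero, zpow_one, mul_comm]

theorem center_x (C : Cell D) (j : Fin (D - 1)) :
    C.center.x j = ((C.k j : ℝ) + 1 / 2) * 2 ^ C.level := rfl

theorem center_injective : Function.Injective (center : Cell D → HalfSpace D) := by
  intro C C' h
  have hl : C.level = C'.level := by
    have hz := congrArg HalfSpace.z h
    simp only [center] at hz
    have := zpow_right_injective₀ (a := (2 : ℝ)) two_pos (by norm_num)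
      (mul_left_cancel₀ three_ne_zero hz)
    omega
  refine Cell.ext (funext fun j => ?_) hl
  have hx : C.center.x j = C'.center.x j := by rw [h]
  rw [center_x, center_x, hl] at hx
  exact Int.cast_injective (add_right_cancel (mul_right_cancel₀ (by positivity) hx))

theorem IsParent.abs_center_sub_le {P C : Cell D} (h : P.IsParent C) (j : Fin (D - 1)) :
    |P.center.x j - C.center.x j| ≤ 2 ^ C.level / 2 := by
  obtain ⟨hl, hs⟩ := h
  have pos : (0 : ℝ) < 2 ^ C.level := by positivity
  -- The two extreme corners of the upper facet of `C` pin down its position below `P`.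
  have corner : ∀ c : ℝ, 0 ≤ c → c ≤ 1 →
      (P.k j : ℝ) * 2 ^ P.level ≤ ((C.k j : ℝ) + c) * 2 ^ C.level ∧
        ((C.k j : ℝ) + c) * 2 ^ C.level ≤ ((P.k j : ℝ) + 1) * 2 ^ P.level := by
    intro c hc0 hc1
    have := hs (a := ⟨WithLp.toLp 2 fun j => ((C.k j : ℝ) + c) * 2 ^ C.level,
      2 ^ (C.level + 1), by positivity⟩)
      ⟨⟨fun j => ⟨by dsimp only; gcongr; linarith, by dsimp only; gcongr⟩,
        zpow_le_zpow_right₀ one_le_two (by simp), le_rfl⟩, rfl⟩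
    exact this.1.1 j
  have h0 := (corner 0 le_rfl zero_le_one).1
  have h1 := (corner 1 zero_le_one le_rfl).2
  rw [center_x, center_x]
  rw [hl, two_zpow_succ] at *
  rw [abs_le]
  constructor <;> linarith

theorem IsHorizontalNeighbor.abs_center_sub_le {C C' : Cell D} (h : C.IsHorizontalNeighbor C')
    (j : Fin (D - 1)) : |C.center.x j - C'.center.x j| ≤ 2 ^ C.level := by
  obtain ⟨hl, -, p, hp, hp'⟩ := h
  have h1 := hp.1 j
  have h2 := hp'.1 j
  rw [center_x, center_x]
  rw [hl] at *
  rw [abs_le]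
  constructor <;> linarith

theorem abs_sub_center_le {C : Cell D} {p : HalfSpace D} (hp : p ∈ C.carrier) (j : Fin (D - 1)) :
    |p.x j - C.center.x j| ≤ 2 ^ C.level / 2 := by
  have h1 := hp.1 j
  rw [center_x, abs_le]
  constructor <;> linarith

end Cell

namespace DiscreteModel

variable {D : ℕ}

/-! ### The hyperbolic distance is bounded by path lengths -/

/-- `L` is an upper bound for the levels along the path and `e` counts the moves that are not needed
to climb to level `L` and back. The subtracted term `2 ^ C'.level / 2` makes the bound inductive: it
pays for descending from `C'`, whose shifts form a geometric series. -/
theorem Path.displacement {u v : DiscreteModel D} {n h : ℕ} (hp : Path u v n h) :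
    ∀ C C' : Cell D, C.center = u → C'.center = v → ∃ (L : ℤ) (e : ℕ),
      C.level ≤ L ∧ C'.level ≤ L ∧ (n : ℤ) = 2 * L - C.level - C'.level + e ∧
      ∀ j, |C.center.x j - C'.center.x j| ≤ 2 ^ L * (1 + (e : ℝ)) - 2 ^ C'.level / 2 := by
  induction hp with
  | nil =>
    intro C C' hC hC'
    obtain rfl := Cell.center_injective (hC.trans hC'.symm)
    refine ⟨C.level, 0, le_rfl, le_rfl, by push_cast; ring, fun j => ?_⟩
    have pos : (0 : ℝ) < 2 ^ C.level := by positivity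
    simp only [sub_self, abs_zero, Nat.cast_zero]
    linarith
  | vertical _ hv ih =>
    intro C C' hC hC'
    obtain ⟨B, B', hB, hB', hpar⟩ := hv
    obtain rfl := Cell.center_injective (hB'.trans hC'.symm)
    obtain ⟨L, e, h1, h2, h3, h4⟩ := ih C B hC hB
    rcases hpar with hpar | hpar
    · have hl := hpar.1
      have e1 := Cell.two_zpow_succ B.level
      have pos : (0 : ℝ) < 2 ^ B.level := by positivity
      rcases h2.lt_or_eq with hlt | heq
      · refine ⟨L, e + 2, h1, by omega, by push_cast; omega, fun j => ?_⟩
        have hm := hpar.abs_center_sub_le j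
        have ht := abs_sub_le (C.center.x j) (B.center.x j) (B'.center.x j)
        rw [abs_sub_comm (B.center.x j)] at ht
        have hle : (2 : ℝ) ^ (B.level + 1) ≤ 2 ^ L := zpow_le_zpow_right₀ one_le_two (by omega)
        have := h4 j
        rw [hl]
        push_cast
        linarith
      · refine ⟨L + 1, e, by omega, by omega, by push_cast; omega, fun j => ?_⟩
        have hm := hpar.abs_center_sub_le j
        have ht := abs_sub_le (C.center.x j) (B.center.x j) (B'.center.x j)
        rw [abs_sub_comm (B.center.x j)] at ht
        have := h4 j
        have he : 0 ≤ (2 : ℝ) ^ L * e := by positivity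
        rw [hl, Cell.two_zpow_succ, Cell.two_zpow_succ]
        rw [heq] at *
        linarith
    · have hl := hpar.1
      refine ⟨L, e, h1, by omega, by push_cast; omega, fun j => ?_⟩
      have hm := hpar.abs_center_sub_le j
      have ht := abs_sub_le (C.center.x j) (B.center.x j) (B'.center.x j)
      have := h4 j
      rw [hl, Cell.two_zpow_succ] at this
      linarith
  | horizontal _ hv ih =>
    intro C C' hC hC'
    obtain ⟨B, B', hB, hB', hn⟩ := hv
    obtain rfl := Cell.center_injective (hB'.trans hC'.symm)
    obtain ⟨L, e, h1, h2, h3, h4⟩ := ih C B hC hB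
    have hl := hn.1
    refine ⟨L, e + 1, h1, by omega, by push_cast; omega, fun j => ?_⟩
    have hm := hn.abs_center_sub_le j
    have ht := abs_sub_le (C.center.x j) (B.center.x j) (B'.center.x j)
    have hle : (2 : ℝ) ^ B.level ≤ 2 ^ L := zpow_le_zpow_right₀ one_le_two h2
    have := h4 j
    rw [hl]
    push_cast
    linarith

theorem two_add_sq_le (e : ℕ) : (2 + (e : ℝ)) ^ 2 ≤ 16 * 2 ^ e := by
  have : (e : ℝ) ^ 2 + 4 * e + 12 ≤ 16 * 2 ^ e := by
    induction e with
    | zero => norm_num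
    | succ e ih => push_cast; rw [pow_succ 2 e]; nlinarith [sq_nonneg (e : ℝ)]
  linarith

theorem sqRatio_le_of_path (hD : 2 ≤ D) {C C' : Cell D} {u v : DiscreteModel D} {n h : ℕ}
    (hp : Path u v n h) (hC : C.center = u) (hC' : C'.center = v) {p q : HalfSpace D}
    (hpC : p ∈ C.carrier) (hqC : q ∈ C'.carrier) :
    HalfSpace.sqRatio p q ≤ D * (16 * 2 ^ n) := by
  obtain ⟨L, e, h1, h2, h3, h4⟩ := hp.displacement C C' hC hC'
  have hp1 : (2 : ℝ) ^ C.level ≤ 2 ^ L := zpow_le_zpow_right₀ one_le_two h1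
  have hq1 : (2 : ℝ) ^ C'.level ≤ 2 ^ L := zpow_le_zpow_right₀ one_le_two h2
  have hpos : (0 : ℝ) < 2 ^ L := by positivity
  have he : 0 ≤ (2 : ℝ) ^ L * e := by positivity
  set S : ℝ := 2 ^ L * (2 + (e : ℝ)) with hS
  have hx : ∀ j, |p.x j - q.x j| ≤ S := by
    intro j
    have a1 := Cell.abs_sub_center_le hpC j
    have a2 := Cell.abs_sub_center_le hqC j
    have a3 := abs_sub_le (p.x j) (C.center.x j) (q.x j)
    have a4 := abs_sub_le (C.center.x j) (C'.center.x j) (q.x j)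
    rw [abs_sub_comm (C'.center.x j)] at a4
    have := h4 j
    linarith
  have hnorm : ‖p.x - q.x‖ ^ 2 ≤ ((D : ℝ) - 1) * S ^ 2 := by
    rw [EuclideanSpace.norm_sq_eq]
    calc ∑ j, ‖(p.x - q.x) j‖ ^ 2 ≤ ∑ _j : Fin (D - 1), S ^ 2 :=
          Finset.sum_le_sum fun j _ => pow_le_pow_left₀ (norm_nonneg _) (hx j) 2
      _ = ((D : ℝ) - 1) * S ^ 2 := by
          rw [Finset.sum_const, Finset.card_univ, Fintype.card_fin, nsmul_eq_mul,
            Nat.cast_sub (by omega), Nat.cast_one]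
  have hz : (p.z - q.z) ^ 2 ≤ S ^ 2 := by
    have b1 := hpC.2.2
    have b2 := hqC.2.2
    rw [Cell.two_zpow_succ] at b1 b2
    have := p.z_pos
    have := q.z_pos
    apply sq_le_sq' <;> linarith
  have hzz : (2 : ℝ) ^ (C.level + C'.level) ≤ p.z * q.z := by
    rw [zpow_add₀ two_ne_zero]
    exact mul_le_mul hpC.2.1 hqC.2.1 (by positivity) p.z_pos.le
  have hpw : (2 : ℝ) ^ L * 2 ^ L * 2 ^ e = 2 ^ n * 2 ^ (C.level + C'.level) := by
    rw [← zpow_natCast, ← zpow_natCast, ← zpow_add₀ two_ne_zero, ← zpow_add₀ two_ne_zero,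
      ← zpow_add₀ two_ne_zero]
    congr 1
    omega
  rw [HalfSpace.sqRatio, div_le_iff₀ (mul_pos p.z_pos q.z_pos)]
  calc ‖p.x - q.x‖ ^ 2 + (p.z - q.z) ^ 2 ≤ D * S ^ 2 := by linarith
    _ = D * (2 ^ L * 2 ^ L * (2 + (e : ℝ)) ^ 2) := by rw [hS]; ring
    _ ≤ D * (2 ^ L * 2 ^ L * (16 * 2 ^ e)) := by gcongr; exact two_add_sq_le e
    _ = D * (16 * (2 ^ L * 2 ^ L * 2 ^ e)) := by ring
    _ = D * (16 * 2 ^ n) * 2 ^ (C.level + C'.level) := by rw [hpw]; ring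
    _ ≤ D * (16 * 2 ^ n) * (p.z * q.z) := by gcongr

theorem dH_le_of_path (hD : 2 ≤ D) {C C' : Cell D} {u v : DiscreteModel D} {n h : ℕ}
    (hp : Path u v n h) (hC : C.center = u) (hC' : C'.center = v) {p q : HalfSpace D}
    (hpC : p ∈ C.carrier) (hqC : q ∈ C'.carrier) :
    HalfSpace.dH p q ≤ Real.log 2 * n + Real.log D + Real.log 64 := by
  have hD1 : (1 : ℝ) ≤ D := by exact_mod_cast (by omega : 1 ≤ D)
  have h2n : (1 : ℝ) ≤ 2 ^ n := one_le_pow₀ one_le_two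
  refine (HalfSpace.dH_le ?_ (sqRatio_le_of_path hD hp hC hC' hpC hqC)).trans_eq ?_
  · nlinarith
  · rw [show (4 : ℝ) * (D * (16 * 2 ^ n)) = 2 ^ n * D * 64 by ring,
      Real.log_mul (by positivity) (by norm_num), Real.log_mul (by positivity) (by positivity),
      Real.log_pow]
    ring

/-! ### Short paths with at most one horizontal move -/

theorem mem_ancestor {C : Cell D} {p : HalfSpace D} (hp : p ∈ C.carrier) (n : ℕ)
    (j : Fin (D - 1)) :
    ((C.k j / 2 ^ n : ℤ) : ℝ) * 2 ^ (C.level + n) ≤ p.x j ∧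
      p.x j ≤ (((C.k j / 2 ^ n : ℤ) : ℝ) + 1) * 2 ^ (C.level + n) := by
  obtain ⟨h1, h2⟩ := hp.1 j
  have pos : (0 : ℝ) < 2 ^ C.level := by positivity
  have hn : (0 : ℤ) < 2 ^ n := by positivity
  have a1 : ((C.k j / 2 ^ n : ℤ) : ℝ) * 2 ^ n ≤ C.k j := by
    exact_mod_cast Int.ediv_mul_le (C.k j) hn.ne'
  have a2 : (C.k j : ℝ) + 1 ≤ (((C.k j / 2 ^ n : ℤ) : ℝ) + 1) * 2 ^ n := by
    exact_mod_cast Int.lt_ediv_add_one_mul_self (C.k j) hn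
  rw [zpow_add₀ two_ne_zero, zpow_natCast]
  constructor
  · calc _ = ((C.k j / 2 ^ n : ℤ) : ℝ) * 2 ^ n * 2 ^ C.level := by ring
      _ ≤ C.k j * 2 ^ C.level := by gcongr
      _ ≤ _ := h1
  · calc _ ≤ ((C.k j : ℝ) + 1) * 2 ^ C.level := h2
      _ ≤ (((C.k j / 2 ^ n : ℤ) : ℝ) + 1) * 2 ^ n * 2 ^ C.level := by gcongr
      _ = _ := by ring

theorem carrier_inter_nonempty {A B : Cell D} (hl : B.level = A.level)
    (h : ∀ j, A.k j ≤ B.k j + 1 ∧ B.k j ≤ A.k j + 1) : (A.carrier ∩ B.carrier).Nonempty := by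
  have pos : (0 : ℝ) < 2 ^ A.level := by positivity
  have hz : (2 : ℝ) ^ A.level ≤ 2 ^ (A.level + 1) := zpow_le_zpow_right₀ one_le_two (by simp)
  have hmax : ∀ j, (A.k j : ℝ) ≤ (max (A.k j) (B.k j) : ℤ) ∧
      (B.k j : ℝ) ≤ (max (A.k j) (B.k j) : ℤ) ∧
      ((max (A.k j) (B.k j) : ℤ) : ℝ) ≤ A.k j + 1 ∧
      ((max (A.k j) (B.k j) : ℤ) : ℝ) ≤ B.k j + 1 := by
    intro j
    have := h j
    exact_mod_cast (by omega : A.k j ≤ max (A.k j) (B.k j) ∧ B.k j ≤ max (A.k j) (B.k j) ∧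
      max (A.k j) (B.k j) ≤ A.k j + 1 ∧ max (A.k j) (B.k j) ≤ B.k j + 1)
  refine ⟨⟨WithLp.toLp 2 fun j => (max (A.k j) (B.k j) : ℤ) * 2 ^ A.level, 2 ^ A.level, pos⟩,
    ⟨fun j => ⟨?_, ?_⟩, le_rfl, hz⟩, ⟨fun j => ⟨?_, ?_⟩, by rw [hl], by rw [hl]; exact hz⟩⟩
  · exact mul_le_mul_of_nonneg_right (hmax j).1 pos.le
  · exact mul_le_mul_of_nonneg_right (hmax j).2.2.1 pos.le
  · rw [hl]
    exact mul_le_mul_of_nonneg_right (hmax j).2.1 pos.le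
  · rw [hl]
    exact mul_le_mul_of_nonneg_right (hmax j).2.2.2 pos.le

theorem Path.d2_le {u v : DiscreteModel D} {n h : ℕ} (hp : Path u v n h) (hh : h ≤ 1) :
    d2 u v ≤ n :=
  Nat.sInf_le ⟨h, hh, hp⟩

theorem d2_le {C C' : Cell D} {p q : HalfSpace D} (hpC : p ∈ C.carrier) (hqC : q ∈ C'.carrier)
    {n m : ℕ} (hl : C'.level + m = C.level + n) (hx : ‖p.x - q.x‖ < 2 ^ (C.level + (n : ℤ))) :
    d2 ⟨C.center, C, rfl⟩ ⟨C'.center, C', rfl⟩ ≤ n + m + 1 := by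
  have up := (path_up_down C n).1
  have down := (path_up_down C' m).2
  have pos : (0 : ℝ) < 2 ^ (C.level + (n : ℤ)) := by positivity
  have hk : ∀ j, C.k j / 2 ^ n ≤ C'.k j / 2 ^ m + 1 ∧ C'.k j / 2 ^ m ≤ C.k j / 2 ^ n + 1 := by
    intro j
    have a1 := mem_ancestor hpC n j
    have a2 := mem_ancestor hqC m j
    rw [hl] at a2
    have a3 : |p.x j - q.x j| < 2 ^ (C.level + (n : ℤ)) :=
      (PiLp.norm_apply_le (p.x - q.x) j).trans_lt hx
    rw [abs_lt] at a3
    -- The strict inequality in `hx` excludes indices that differ by two.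
    have b1 : ((C.k j / 2 ^ n : ℤ) : ℝ) < ((C'.k j / 2 ^ m : ℤ) : ℝ) + 2 :=
      lt_of_mul_lt_mul_right (by linarith) pos.le
    have b2 : ((C'.k j / 2 ^ m : ℤ) : ℝ) < ((C.k j / 2 ^ n : ℤ) : ℝ) + 2 :=
      lt_of_mul_lt_mul_right (by linarith) pos.le
    have c1 : C.k j / 2 ^ n < C'.k j / 2 ^ m + 2 := by exact_mod_cast b1
    have c2 : C'.k j / 2 ^ m < C.k j / 2 ^ n + 2 := by exact_mod_cast b2
    omega
  have hne := carrier_inter_nonempty (A := ⟨fun j => C.k j / 2 ^ n, C.level + n⟩)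
    (B := ⟨fun j => C'.k j / 2 ^ m, C'.level + m⟩) hl hk
  generalize hA : (⟨fun j => C.k j / 2 ^ n, C.level + n⟩ : Cell D) = A at up hne
  generalize hB : (⟨fun j => C'.k j / 2 ^ m, C'.level + m⟩ : Cell D) = B at down hne
  have hlevel : B.level = A.level := by rw [← hA, ← hB]; exact hl
  by_cases hAB : B = A
  · subst hAB
    exact ((up.trans down).d2_le (by norm_num)).trans (Nat.le_succ _)
  · refine (((up.horizontal ⟨A, B, rfl, rfl, hlevel, hAB, hne⟩).trans down).d2_le ?_).trans ?_
    · norm_num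
    · omega

/-- The final inequality bounds the length `2L - i - j + 1` of the path through level `L` by `d_H`, up
to an additive constant. -/
theorem exists_common_level {C C' : Cell D} {p q : HalfSpace D} (hpC : p ∈ C.carrier)
    (hqC : q ∈ C'.carrier) : ∃ L : ℤ, C.level ≤ L ∧ C'.level ≤ L ∧ ‖p.x - q.x‖ < 2 ^ L ∧
      (2 : ℝ) ^ (2 * L - C.level - C'.level - 5) ≤ 1 + HalfSpace.sqRatio p q / 2 := by
  have hp := p.z_pos
  have hq := q.z_pos
  obtain ⟨hp1, hp2⟩ := hpC.2
  obtain ⟨hq1, hq2⟩ := hqC.2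
  have two : (2 : ℝ) ≠ 0 := two_ne_zero
  -- With `t` as in `HalfSpace.sqRatio`, `1 + t ^ 2 / 2` is at least half the ratio of the two heights.
  have ratio : ∀ a b : ℝ, 0 < a → 0 < b → ∀ i j : ℤ, a ≤ 2 ^ (i + 1) → 2 ^ j ≤ b → ∀ s : ℝ, 0 ≤ s →
      (2 : ℝ) ^ (j - i - 5) ≤ 1 + (s + (a - b) ^ 2) / (a * b) / 2 := by
    intro a b ha hb i j hai hbj s hs
    have h1 : (2 : ℝ) ^ (j - i - 5) ≤ b / (2 * a) := by
      rw [le_div_iff₀ (by positivity)]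
      calc (2 : ℝ) ^ (j - i - 5) * (2 * a) ≤ 2 ^ (j - i - 5) * (2 * 2 ^ (i + 1)) := by gcongr
        _ = 2 ^ (j - i - 5 + (1 + (i + 1))) := by
            rw [zpow_add₀ two (j - i - 5), zpow_add₀ two 1, zpow_one]
        _ ≤ 2 ^ j := zpow_le_zpow_right₀ one_le_two (by omega)
        _ ≤ b := hbj
    refine h1.trans ?_
    rw [← sub_nonneg, show 1 + (s + (a - b) ^ 2) / (a * b) / 2 - b / (2 * a) =
      (s + a ^ 2) / (2 * (a * b)) by field_simp; ring]
    positivity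
  by_cases hM : ‖p.x - q.x‖ < 2 ^ max C.level C'.level
  · refine ⟨_, le_max_left _ _, le_max_right _ _, hM, ?_⟩
    rcases le_total C.level C'.level with h | h
    · rw [max_eq_right h]
      refine le_trans (le_of_eq ?_) (ratio p.z q.z hp hq _ _ hp2 hq1 (‖p.x - q.x‖ ^ 2) (by positivity))
      congr 1; ring
    · rw [max_eq_left h]
      refine le_trans (le_of_eq ?_)
        ((ratio q.z p.z hq hp _ _ hq2 hp1 (‖p.x - q.x‖ ^ 2) (by positivity)).trans_eq ?_)
      · congr 1; ring
      · rw [HalfSpace.sqRatio, mul_comm q.z, sub_sq_comm q.z]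
  · rw [not_lt] at hM
    have hMpos : 0 < ‖p.x - q.x‖ := lt_of_lt_of_le (by positivity) hM
    set l := Int.log 2 ‖p.x - q.x‖ with hl
    have h1 : (2 : ℝ) ^ l ≤ ‖p.x - q.x‖ := by
      exact_mod_cast Int.zpow_log_le_self (b := 2) one_lt_two hMpos
    have h2 : ‖p.x - q.x‖ < (2 : ℝ) ^ (l + 1) := by
      exact_mod_cast Int.lt_zpow_succ_log_self (b := 2) one_lt_two ‖p.x - q.x‖
    have h3 := (zpow_lt_zpow_iff_right₀ (one_lt_two : (1 : ℝ) < 2)).1 (hM.trans_lt h2)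
    refine ⟨l + 1, by omega, by omega, h2, ?_⟩
    have h4 : (2 : ℝ) ^ (2 * (l + 1) - C.level - C'.level - 5) ≤
        ‖p.x - q.x‖ ^ 2 / (2 * (p.z * q.z)) := by
      rw [le_div_iff₀ (by positivity)]
      calc (2 : ℝ) ^ (2 * (l + 1) - C.level - C'.level - 5) * (2 * (p.z * q.z))
          ≤ 2 ^ (2 * (l + 1) - C.level - C'.level - 5) *
            (2 * (2 ^ (C.level + 1) * 2 ^ (C'.level + 1))) := by gcongr
        _ = 2 ^ (2 * (l + 1) - C.level - C'.level - 5 + (1 + (C.level + 1 + (C'.level + 1)))) := by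
            rw [zpow_add₀ two (2 * (l + 1) - C.level - C'.level - 5), zpow_add₀ two 1,
              zpow_add₀ two (C.level + 1), zpow_one]
        _ = 2 ^ (l + l) := by congr 1; ring
        _ = (2 ^ l) ^ 2 := by rw [zpow_add₀ two, sq]
        _ ≤ ‖p.x - q.x‖ ^ 2 := by gcongr
    refine h4.trans ?_
    rw [HalfSpace.sqRatio, ← sub_nonneg,
      show 1 + (‖p.x - q.x‖ ^ 2 + (p.z - q.z) ^ 2) / (p.z * q.z) / 2 -
        ‖p.x - q.x‖ ^ 2 / (2 * (p.z * q.z)) = 1 + (p.z - q.z) ^ 2 / (2 * (p.z * q.z)) by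
          field_simp; ring]
    positivity

theorem log_two_mul_d2_le {C C' : Cell D} {p q : HalfSpace D} (hpC : p ∈ C.carrier)
    (hqC : q ∈ C'.carrier) :
    Real.log 2 * (d2 ⟨C.center, C, rfl⟩ ⟨C'.center, C', rfl⟩ : ℝ) ≤
      HalfSpace.dH p q + Real.log 64 := by
  obtain ⟨L, h1, h2, h3, h4⟩ := exists_common_level hpC hqC
  have hn : C.level + ((L - C.level).toNat : ℤ) = L := by omega
  have hd := d2_le hpC hqC (n := (L - C.level).toNat) (m := (L - C'.level).toNat) (by omega)
    (by rwa [hn])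
  set d := d2 (⟨C.center, C, rfl⟩ : DiscreteModel D) ⟨C'.center, C', rfl⟩
  have hle : (2 : ℝ) ^ d ≤ 64 * (1 + HalfSpace.sqRatio p q / 2) := by
    calc (2 : ℝ) ^ d = 2 ^ (d : ℤ) := (zpow_natCast _ _).symm
      _ ≤ 2 ^ (6 + (2 * L - C.level - C'.level - 5)) :=
          zpow_le_zpow_right₀ one_le_two (by omega)
      _ = 64 * 2 ^ (2 * L - C.level - C'.level - 5) := by
          rw [zpow_add₀ two_ne_zero]; norm_num
      _ ≤ _ := by gcongr
  have hpos : 0 < 1 + HalfSpace.sqRatio p q / 2 := lt_of_lt_of_le (by positivity) h4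
  have hlog := Real.log_le_log (by positivity) hle
  rw [Real.log_pow, Real.log_mul (by norm_num) hpos.ne'] at hlog
  linarith [HalfSpace.log_one_add_sqRatio_le p q]

/-! ### Comparison of the three distances -/

theorem d1_le_d2 (u v : DiscreteModel D) : d1 u v ≤ d2 u v := by
  obtain ⟨n, hn⟩ := exists_path u v
  obtain ⟨h, -, hp⟩ := Nat.sInf_mem (s := {n | ∃ h ≤ 1, Path u v n h}) ⟨n, hn⟩
  exact Nat.sInf_le ⟨h, hp⟩

theorem exists_path_d1 (u v : DiscreteModel D) : ∃ h, Path u v (d1 u v) h := by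
  obtain ⟨n, h, -, hp⟩ := exists_path u v
  exact Nat.sInf_mem (s := {n | ∃ h, Path u v n h}) ⟨n, h, hp⟩

end DiscreteModel

theorem theorem2 :
    ∃ K : ℝ, ∀ D : ℕ, 2 ≤ D →
      ∀ b : HalfSpace D → DiscreteModel D, DiscreteModel.IsCellCenterMap b →
        ∀ p q : HalfSpace D,
          |HalfSpace.dH p q - Real.log 2 * (DiscreteModel.d1 (b p) (b q) : ℝ)|
              ≤ 3 * Real.log D + K ∧
          |HalfSpace.dH p q - Real.log 2 * (DiscreteModel.d2 (b p) (b q) : ℝ)|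
              ≤ 3 * Real.log D + K := by
  refine ⟨Real.log 64, fun D hD b hb p q => ?_⟩
  obtain ⟨C, hC, hpC, -⟩ := hb p
  obtain ⟨C', hC', hqC, -⟩ := hb q
  have eC : (⟨C.center, C, rfl⟩ : DiscreteModel D) = b p := Subtype.ext hC
  have eC' : (⟨C'.center, C', rfl⟩ : DiscreteModel D) = b q := Subtype.ext hC'
  obtain ⟨h, hp⟩ := DiscreteModel.exists_path_d1 (b p) (b q)
  have upper := DiscreteModel.dH_le_of_path hD hp hC hC' hpC hqC
  have lower := DiscreteModel.log_two_mul_d2_le hpC hqC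
  rw [eC, eC'] at lower
  have h12 : Real.log 2 * (DiscreteModel.d1 (b p) (b q) : ℝ) ≤
      Real.log 2 * (DiscreteModel.d2 (b p) (b q) : ℝ) :=
    mul_le_mul_of_nonneg_left (by exact_mod_cast DiscreteModel.d1_le_d2 (b p) (b q))
      (Real.log_nonneg one_le_two)
  have hlogD : 0 ≤ Real.log D := Real.log_nonneg (by exact_mod_cast (by omega : 1 ≤ D))
  constructor <;> rw [abs_le] <;> constructor <;> linarith
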